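/- Let $\mu$ be a Borel probability measure on $\mathbb R^d$, $d\ge1$, and let $\mathcal H$ be the family of all closed halfspaces of $\mathbb R^d$. For a finite signed Borel measure $\nu$ on $\mathbb R^d$ put $$D_\nu(x)=\inf\{\nu(H): H\in\mathcal H,\ x\in H\},\qquad \mathcal R_\nu(\alpha)=\{x\in\mathbb R^d: D_\nu(x)\ge\alpha\}.$$ Write $\mathcal R(\alpha)=\mathcal R_\mu(\alpha)$ and $\alpha_{\max}=\sup_{x\in\mathbb R^d}D_\mu(x)$. Let $X_1,X_2,\dots$ be independent random vectors with distribution $\mu$, and let $\xi_1,\xi_2,\dots$ be i.i.d. integrable real random variables (possibly taking negative values) with $\mathbb E\xi_1=1$, such that the sequence $(\xi_i)_{i\ge1}$ is independent of the sequence $(X_i)_{i\ge1}$. Let $\hat\mu_n=n^{-1}\sum_{i=1}^n\xi_i\delta_{X_i}$ be the weighted empirical measure and $\hat{\mathcal R}_n(\alpha)=\mathcal R_{\hat\mu_n}(\alpha)$ the empirical depth trimmed region. Assume that (C1) $\mu(E)=0$ for every hyperplane $E$ of $\mathbb R^d$; (C2) if $H_1,H_2\in\mathcal H$ are disjoint and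 $\mu(H_1),\mu(H_2)>0$, then $\mu(H_1)+\mu(H_2)<1$. Then, for every $\alpha\in(0,\alpha_{\max})$, $$\rho_H\bigl(\mathcal R(\alpha),\hat{\mathcal R}_n(\alpha)\bigr)\to0\quad\text{almost surely as } n\to\infty,$$ where $\rho_H$ is the Hausdorff distance with values in $[0,\infty]$ (equal to $\infty$ if exactly one of the two sets is empty). -/

import Mathlib

open MeasureTheory ProbabilityTheory Filter Topology

noncomputable section

namespace HalfspaceDepth

variable {d : ℕ}

/-- The closed halfspace `{z : ⟨z, u⟩ ≤ t}`. -/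
def closedHalfspace (u : EuclideanSpace ℝ (Fin d)) (t : ℝ) : Set (EuclideanSpace ℝ (Fin d)) :=
  {z | inner ℝ z u ≤ t}

/-- The hyperplane `{z : ⟨z, u⟩ = t}`. -/
def hyperplane (u : EuclideanSpace ℝ (Fin d)) (t : ℝ) : Set (EuclideanSpace ℝ (Fin d)) :=
  {z | inner ℝ z u = t}

/-- The family of all closed halfspaces of `ℝ^d`. -/
def IsClosedHalfspace (H : Set (EuclideanSpace ℝ (Fin d))) : Prop :=
  ∃ (u : EuclideanSpace ℝ (Fin d)) (t : ℝ), ‖u‖ = 1 ∧ H = closedHalfspace u t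

/-- The family of all (affine) hyperplanes of `ℝ^d`. -/
def IsHyperplane (A : Set (EuclideanSpace ℝ (Fin d))) : Prop :=
  ∃ (u : EuclideanSpace ℝ (Fin d)) (t : ℝ), ‖u‖ = 1 ∧ A = hyperplane u t

/-- Hyperplanes have no mass. -/
def NoMassOnHyperplanes (μ : Measure (EuclideanSpace ℝ (Fin d))) : Prop :=
  ∀ A, IsHyperplane A → μ A = 0

/-- Contiguity of the support: two disjoint closed halfspaces of positive measure
never carry the whole mass. -/
def ContiguousSupport (μ : Measure (EuclideanSpace ℝ (Fin d))) : Prop :=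
  ∀ H₁ H₂, IsClosedHalfspace H₁ → IsClosedHalfspace H₂ → Disjoint H₁ H₂ →
    0 < μ H₁ → 0 < μ H₂ → μ H₁ + μ H₂ < 1

/-- The halfspace (Tukey) depth of `x` with respect to a finite signed measure `ν`: the infimum of
`ν H` over all closed halfspaces `H` containing `x`. -/
def depth (ν : SignedMeasure (EuclideanSpace ℝ (Fin d))) (x : EuclideanSpace ℝ (Fin d)) : ℝ :=
  sInf ((fun H => ν H) '' {H | IsClosedHalfspace H ∧ x ∈ H})

/-- The depth trimmed region at level `α`: the upper level set of the depth function. -/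
def trimmedRegion (ν : SignedMeasure (EuclideanSpace ℝ (Fin d))) (α : ℝ) :
    Set (EuclideanSpace ℝ (Fin d)) :=
  {x | α ≤ depth ν x}

/-- The maximal depth `α_max = sup_x D(x)`. -/
def maxDepth (ν : SignedMeasure (EuclideanSpace ℝ (Fin d))) : ℝ :=
  sSup (Set.range (depth ν))

/-- The weighted empirical measure `n⁻¹ ∑ ξ_i δ_{X_i}` of the first `n` points `X_0, …, X_{n-1}`
with weights `ξ_0, …, ξ_{n-1}`; it is a signed measure, as the weights may be negative. -/
def weightedEmpirical (X : ℕ → EuclideanSpace ℝ (Fin d)) (ξ : ℕ → ℝ) (n : ℕ) :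
    SignedMeasure (EuclideanSpace ℝ (Fin d)) :=
  (n : ℝ)⁻¹ • ∑ i ∈ Finset.range n, ξ i • (Measure.dirac (X i)).toSignedMeasure

end HalfspaceDepth

end

/-! The probabilistic input is a Glivenko-Cantelli theorem: almost surely the weighted empirical
mass converges to `μ` uniformly over closed halfspaces (`ae_uniform_weightedEmpirical`). It follows
from the strong law on finitely many brackets (`exists_finite_brackets`), the weights being split
into positive and negative parts because bracketing needs monotonicity.

The rest is deterministic. If all halfspace masses are within `ε`, so are the depths, hence the
empirical region lies between the regions of `μ` at levels `α + ε` and `α - ε`. It remains to see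
that the regions of `μ` vary continuously with the level. Continuity from below the level is
compactness of nested regions. Continuity from above needs (C2): it excludes plateaus of the depth,
since any step towards a point deeper than `α` leads to depth above `α` (`lt_depth_add_smul_sub`).
-/

/-! ### Strong law for the weighted mass of a fixed set. -/

/-- If `A ⟂ B`, `C ⟂ D` and `(A, B) ⟂ (C, D)`, then `(A, C) ⟂ (B, D)`. -/
theorem ProbabilityTheory.IndepFun.prodMk_prodMk_comm {Ω α β γ δ : Type*} [MeasurableSpace Ω]
    [MeasurableSpace α] [MeasurableSpace β] [MeasurableSpace γ] [MeasurableSpace δ]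
    {P : Measure Ω} [IsProbabilityMeasure P] {A : Ω → α} {B : Ω → β} {C : Ω → γ} {D : Ω → δ}
    (hA : Measurable A) (hB : Measurable B) (hC : Measurable C) (hD : Measurable D)
    (hAB : IndepFun A B P) (hCD : IndepFun C D P)
    (h : IndepFun (fun ω => (A ω, B ω)) (fun ω => (C ω, D ω)) P) :
    IndepFun (fun ω => (A ω, C ω)) (fun ω => (B ω, D ω)) P := by
  have hAC : IndepFun A C P := h.comp measurable_fst measurable_fst
  have hBD : IndepFun B D P := h.comp measurable_snd measurable_snd
  -- Rectangles form a generating π-system; on them both sides factor into the same four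
  -- probabilities.
  refine IndepSets.indep (hA.prodMk hC).comap_le (hB.prodMk hD).comap_le
    (IsPiSystem.comap isPiSystem_prod _) (IsPiSystem.comap isPiSystem_prod _)
    (by rw [← generateFrom_prod, MeasurableSpace.comap_generateFrom]; rfl)
    (by rw [← generateFrom_prod, MeasurableSpace.comap_generateFrom]; rfl) ?_
  rw [IndepSets_iff]
  rintro _ _ ⟨_, ⟨a, ha, c, hc, rfl⟩, rfl⟩ ⟨_, ⟨b, hb, e, he, rfl⟩, rfl⟩
  have ha' : MeasurableSet a := ha
  have hb' : MeasurableSet b := hb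
  have hc' : MeasurableSet c := hc
  have he' : MeasurableSet e := he
  have e1 : (fun ω => (A ω, C ω)) ⁻¹' a ×ˢ c ∩ (fun ω => (B ω, D ω)) ⁻¹' b ×ˢ e =
      (fun ω => (A ω, B ω)) ⁻¹' a ×ˢ b ∩ (fun ω => (C ω, D ω)) ⁻¹' c ×ˢ e := by
    ext ω; simp only [Set.mem_inter_iff, Set.mem_preimage, Set.mem_prod]; tauto
  rw [e1, h.measure_inter_preimage_eq_mul _ _ (ha'.prod hb') (hc'.prod he')]
  simp only [Set.mk_preimage_prod]
  rw [hAB.measure_inter_preimage_eq_mul _ _ ha' hb', hCD.measure_inter_preimage_eq_mul _ _ hc' he',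
    hAC.measure_inter_preimage_eq_mul _ _ ha' hc', hBD.measure_inter_preimage_eq_mul _ _ hb' he']
  ring

namespace HalfspaceDepth

/-- The strong law of large numbers for the weighted empirical mass of a fixed set. -/
theorem ae_tendsto_weighted_mass {E : Type*} [MeasurableSpace E] {μ : Measure E}
    {Ω : Type*} [MeasurableSpace Ω] {P : Measure Ω} [IsProbabilityMeasure P]
    {X : ℕ → Ω → E} {ξ : ℕ → Ω → ℝ}
    (hX_meas : ∀ i, Measurable (X i)) (hX_law : ∀ i, P.map (X i) = μ)
    (hX_indep : iIndepFun X P)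
    (hξ_meas : ∀ i, Measurable (ξ i)) (hξ_ident : ∀ i, IdentDistrib (ξ i) (ξ 0) P P)
    (hξ_indep : iIndepFun ξ P)
    (hXξ_indep : IndepFun (fun ω i => X i ω) (fun ω i => ξ i ω) P)
    {g : ℝ → ℝ} (hg : Measurable g) (hg_int : Integrable (fun ω => g (ξ 0 ω)) P)
    {A : Set E} (hA : MeasurableSet A) :
    ∀ᵐ ω ∂P, Tendsto
      (fun n : ℕ => (n : ℝ)⁻¹ * ∑ i ∈ Finset.range n, g (ξ i ω) * A.indicator 1 (X i ω))
      atTop (𝓝 ((∫ ω, g (ξ 0 ω) ∂P) * μ.real A)) := by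
  have hI : Measurable (A.indicator (1 : E → ℝ)) := measurable_one.indicator hA
  have hf : Measurable (fun p : E × ℝ => g p.2 * A.indicator 1 p.1) :=
    (hg.comp measurable_snd).mul (hI.comp measurable_fst)
  have hXξ (i : ℕ) : IndepFun (X i) (ξ i) P :=
    hXξ_indep.comp (measurable_pi_apply i) (measurable_pi_apply i)
  have hlaw (i : ℕ) : P.map (fun ω => (X i ω, ξ i ω)) = μ.prod (P.map (ξ 0)) := by
    rw [(indepFun_iff_map_prod_eq_prod_map_map (hX_meas i).aemeasurable
      (hξ_meas i).aemeasurable).1 (hXξ i), hX_law, (hξ_ident i).map_eq]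
  have hindep : IndepFun (fun ω => g (ξ 0 ω)) (fun ω => A.indicator (1 : E → ℝ) (X 0 ω)) P :=
    (hXξ 0).symm.comp hg hI
  have hIint : Integrable (fun ω => A.indicator (1 : E → ℝ) (X 0 ω)) P := by
    refine Integrable.of_bound (hI.comp (hX_meas 0)).aestronglyMeasurable 1 (ae_of_all _ fun ω => ?_)
    by_cases h : X 0 ω ∈ A <;> simp [h]
  have hmean : ∫ ω, g (ξ 0 ω) * A.indicator 1 (X 0 ω) ∂P
      = (∫ ω, g (ξ 0 ω) ∂P) * μ.real A := by
    rw [hindep.integral_fun_mul_eq_mul_integral hg_int.aestronglyMeasurable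
      hIint.aestronglyMeasurable]
    congr 1
    rw [← integral_map (φ := X 0) (hX_meas 0).aemeasurable hI.aestronglyMeasurable, hX_law,
      integral_indicator_one hA]
  rw [← hmean]
  refine strong_law_ae (fun i ω => g (ξ i ω) * A.indicator 1 (X i ω))
    (hindep.integrable_mul hg_int hIint) ?_ ?_
  -- The strong law asks only for pairwise independence of the summands, so it is enough to regroup
  -- two positions and two weights.
  · intro i j hij
    have h := ProbabilityTheory.IndepFun.prodMk_prodMk_comm (hX_meas i) (hX_meas j) (hξ_meas i)
      (hξ_meas j) (hX_indep.indepFun hij) (hξ_indep.indepFun hij)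
      (hXξ_indep.comp ((measurable_pi_apply i).prodMk (measurable_pi_apply j))
        ((measurable_pi_apply i).prodMk (measurable_pi_apply j)))
    exact h.comp hf hf
  · intro i
    have h : IdentDistrib (fun ω => (X i ω, ξ i ω)) (fun ω => (X 0 ω, ξ 0 ω)) P P :=
      ⟨((hX_meas i).prodMk (hξ_meas i)).aemeasurable,
        ((hX_meas 0).prodMk (hξ_meas 0)).aemeasurable, by rw [hlaw, hlaw]⟩
    exact h.comp hf

variable {d : ℕ}

/-! ### Brackets and the Glivenko-Cantelli theorem for halfspaces. -/

theorem measurableSet_closedHalfspace (u : EuclideanSpace ℝ (Fin d)) (t : ℝ) :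
    MeasurableSet (closedHalfspace u t) :=
  (isClosed_le (by fun_prop) continuous_const).measurableSet

theorem IsClosedHalfspace.measurableSet {H : Set (EuclideanSpace ℝ (Fin d))}
    (hH : IsClosedHalfspace H) : MeasurableSet H := by
  obtain ⟨u, t, -, rfl⟩ := hH
  exact measurableSet_closedHalfspace u t

/-- The strips decrease to a hyperplane, which is null by (C1), so continuity from above applies. -/
theorem exists_strip_measure_lt {μ : Measure (EuclideanSpace ℝ (Fin d))} [IsProbabilityMeasure μ]
    (hC1 : NoMassOnHyperplanes μ) {u : EuclideanSpace ℝ (Fin d)} (hu : ‖u‖ = 1) (t : ℝ)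
    {ε : ENNReal} (hε : 0 < ε) :
    ∃ δ > 0, μ {z | |inner ℝ z u - t| ≤ δ} < ε := by
  have h := tendsto_measure_biInter_gt (μ := μ) (a := (0 : ℝ))
    (s := fun δ => {z : EuclideanSpace ℝ (Fin d) | |inner ℝ z u - t| ≤ δ})
    (fun r _ => (isClosed_le (by fun_prop) continuous_const).measurableSet.nullMeasurableSet)
    (fun i j _ hij z (hz : _ ≤ _) => hz.trans hij) ⟨1, one_pos, by finiteness⟩
  have h0 : (⋂ r > (0 : ℝ), {z : EuclideanSpace ℝ (Fin d) | |inner ℝ z u - t| ≤ r})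
      ⊆ hyperplane u t := by
    intro z hz
    simp only [Set.mem_iInter] at hz
    have : |inner ℝ z u - t| ≤ 0 := le_of_forall_gt_imp_ge_of_dense hz
    exact sub_eq_zero.1 (abs_eq_zero.1 (this.antisymm (abs_nonneg _)))
  rw [measure_mono_null h0 (hC1 _ ⟨u, t, hu, rfl⟩)] at h
  obtain ⟨δ, h1, h2⟩ := ((h.eventually_lt_const hε).and self_mem_nhdsWithin).exists
  exact ⟨δ, h2, h1⟩

theorem exists_measureReal_compl_closedBall_lt (μ : Measure (EuclideanSpace ℝ (Fin d)))
    [IsProbabilityMeasure μ] {ε : ℝ} (hε : 0 < ε) :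
    ∃ R : ℝ, 0 < R ∧ μ.real (Metric.closedBall (0 : EuclideanSpace ℝ (Fin d)) R)ᶜ < ε := by
  have h := tendsto_measure_compl_closedBall_of_isTightMeasureSet
    (isTightMeasureSet_singleton (μ := μ)) 0
  simp only [Set.mem_singleton_iff, iSup_iSup_eq_left] at h
  obtain ⟨R, h1, h2⟩ := ((h.eventually_lt_const (ENNReal.ofReal_pos.2 hε)).and
    (eventually_gt_atTop 0)).exists
  exact ⟨R, h2, by rwa [Measure.real, ← ENNReal.lt_ofReal_iff_toReal_lt (by finiteness)]⟩

/-- Closed halfspaces have finite bracketing numbers. -/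
theorem exists_finite_brackets {μ : Measure (EuclideanSpace ℝ (Fin d))} [IsProbabilityMeasure μ]
    (hC1 : NoMassOnHyperplanes μ) {ε : ℝ} (hε : 0 < ε) :
    ∃ S : Set (Set (EuclideanSpace ℝ (Fin d)) × Set (EuclideanSpace ℝ (Fin d))), S.Finite ∧
      (∀ p ∈ S, MeasurableSet p.1 ∧ MeasurableSet p.2 ∧ μ.real p.2 ≤ μ.real p.1 + ε) ∧
      ∀ H, IsClosedHalfspace H → ∃ p ∈ S, p.1 ⊆ H ∧ H ⊆ p.2 := by
  obtain ⟨R, hR0, hR⟩ : ∃ R : ℝ, 0 < R ∧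
      μ.real (Metric.closedBall (0 : EuclideanSpace ℝ (Fin d)) R)ᶜ < ε / 2 :=
    exists_measureReal_compl_closedBall_lt μ (half_pos hε)
  set B := Metric.closedBall (0 : EuclideanSpace ℝ (Fin d)) R with hB
  have hBm : MeasurableSet B := Metric.isClosed_closedBall.measurableSet
  have hδ : ∀ q : EuclideanSpace ℝ (Fin d) × ℝ, ∃ δ > 0, ‖q.1‖ = 1 →
      μ.real {z | |inner ℝ z q.1 - q.2| ≤ δ} < ε / 2 := by
    intro q
    by_cases hq : ‖q.1‖ = 1
    · obtain ⟨δ, h1, h2⟩ := exists_strip_measure_lt hC1 hq q.2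
        (ε := ENNReal.ofReal (ε / 2)) (by simpa using hε)
      exact ⟨δ, h1, fun _ => by rwa [Measure.real, ← ENNReal.lt_ofReal_iff_toReal_lt (by finiteness)]⟩
    · exact ⟨1, one_pos, fun h => absurd h hq⟩
  choose δ hδ0 hδ using hδ
  have hK : IsCompact (Metric.sphere (0 : EuclideanSpace ℝ (Fin d)) 1 ×ˢ
      Set.Icc (-R) R) := (isCompact_sphere _ _).prod isCompact_Icc
  -- On the ball `B` of radius `R`, the functions `⟨z, u⟩ - t` of two parameters `p` and `q` differ
  -- by at most `|p.2 - q.2| + R * ‖p.1 - q.1‖`. Over the neighbourhood of `q` the halfspace is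
  -- therefore trapped, inside `B`, between the shifts of that of `q` by `± δ q`.
  obtain ⟨T, hTK, hT⟩ := hK.elim_nhds_subcover
    (fun q => {p | |p.2 - q.2| + R * ‖p.1 - q.1‖ < δ q}) (fun q _ => by
      refine (isOpen_lt (by fun_prop) continuous_const).mem_nhds ?_
      simpa using hδ0 q)
  let br : EuclideanSpace ℝ (Fin d) × ℝ →
      Set (EuclideanSpace ℝ (Fin d)) × Set (EuclideanSpace ℝ (Fin d)) := fun q =>
    (closedHalfspace q.1 (q.2 - δ q) ∩ B, closedHalfspace q.1 (q.2 + δ q) ∪ Bᶜ)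
  -- The two extra brackets serve the noncompact parameters: for `t > R` the halfspace contains `B`,
  -- for `t < -R` it misses `B`.
  refine ⟨insert (B, Set.univ) (insert (∅, Bᶜ) (br '' T)),
    ((T.finite_toSet.image _).insert _).insert _, ?_, ?_⟩
  · rintro p (rfl | rfl | ⟨q, hq, rfl⟩)
    · refine ⟨hBm, .univ, ?_⟩
      have := measureReal_add_measureReal_compl (μ := μ) hBm
      dsimp only; linarith
    · refine ⟨.empty, hBm.compl, ?_⟩
      simp only [measureReal_empty]; linarith
    · have hq1 : ‖q.1‖ = 1 := by simpa using (hTK q hq).1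
      refine ⟨(measurableSet_closedHalfspace _ _).inter hBm,
        (measurableSet_closedHalfspace _ _).union hBm.compl, ?_⟩
      have hsub : (br q).2 ⊆ (br q).1 ∪ {z | |inner ℝ z q.1 - q.2| ≤ δ q} ∪ Bᶜ := by
        rintro z (hz | hz)
        · by_cases hzB : z ∈ B
          · left
            by_cases h : inner ℝ z q.1 ≤ q.2 - δ q
            · exact Or.inl ⟨h, hzB⟩
            · have hz' : inner ℝ z q.1 ≤ q.2 + δ q := hz
              have hz'' : |inner ℝ z q.1 - q.2| ≤ δ q := abs_le.2 ⟨by linarith, by linarith⟩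
              exact Or.inr hz''
          · exact Or.inr hzB
        · exact Or.inr hz
      have h1 := measureReal_mono (μ := μ) hsub
      have h2 := measureReal_union_le (μ := μ) ((br q).1 ∪ {z | |inner ℝ z q.1 - q.2| ≤ δ q}) Bᶜ
      have h3 := measureReal_union_le (μ := μ) (br q).1 {z | |inner ℝ z q.1 - q.2| ≤ δ q}
      linarith [hδ q hq1]
  · rintro H ⟨u, t, hu, rfl⟩
    have habs (z) (hz : z ∈ B) : |inner ℝ z u| ≤ R := by
      have := abs_real_inner_le_norm z u
      rw [hu, mul_one] at this
      exact this.trans (by simpa [hB] using hz)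
    by_cases ht : R < t
    · exact ⟨_, Or.inl rfl, fun z hz => ((le_abs_self _).trans (habs z hz)).trans ht.le,
        Set.subset_univ _⟩
    by_cases ht' : t < -R
    · refine ⟨_, Or.inr (Or.inl rfl), Set.empty_subset _, fun z hz hzB => ?_⟩
      have h1 := (abs_le.1 (habs z hzB)).1
      have h2 : inner ℝ z u ≤ t := hz
      linarith
    have hmem : (u, t) ∈ Metric.sphere (0 : EuclideanSpace ℝ (Fin d)) 1 ×ˢ Set.Icc (-R) R :=
      ⟨by simpa using hu, not_lt.1 ht', not_lt.1 ht⟩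
    obtain ⟨q, hq, hqu⟩ := Set.mem_iUnion₂.1 (hT hmem)
    have hqu : |t - q.2| + R * ‖u - q.1‖ < δ q := hqu
    have key (z) (hz : z ∈ B) : |inner ℝ z u - inner ℝ z q.1| ≤ R * ‖u - q.1‖ := by
      rw [← inner_sub_right]
      refine (abs_real_inner_le_norm _ _).trans ?_
      gcongr
      simpa [hB] using hz
    refine ⟨_, Or.inr (Or.inr ⟨q, hq, rfl⟩), ?_, ?_⟩
    · rintro z ⟨hz, hzB⟩
      have h1 : inner ℝ z q.1 ≤ q.2 - δ q := hz
      have h2 := (abs_le.1 (key z hzB)).2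
      have h3 := neg_abs_le (t - q.2)
      change inner ℝ z u ≤ t
      linarith
    · intro z hz
      by_cases hzB : z ∈ B
      · left
        have h1 : inner ℝ z u ≤ t := hz
        have h2 := (abs_le.1 (key z hzB)).1
        have h3 := le_abs_self (t - q.2)
        change inner ℝ z q.1 ≤ q.2 + δ q
        linarith
      · exact Or.inr hzB

/-- The Glivenko-Cantelli theorem for closed halfspaces, with nonnegative random weights. -/
theorem ae_uniform_weighted_mass_of_nonneg {μ : Measure (EuclideanSpace ℝ (Fin d))}
    [IsProbabilityMeasure μ] (hC1 : NoMassOnHyperplanes μ)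
    {Ω : Type*} [MeasurableSpace Ω] {P : Measure Ω} [IsProbabilityMeasure P]
    {X : ℕ → Ω → EuclideanSpace ℝ (Fin d)} {ξ : ℕ → Ω → ℝ}
    (hX_meas : ∀ i, Measurable (X i)) (hX_law : ∀ i, P.map (X i) = μ)
    (hX_indep : iIndepFun X P)
    (hξ_meas : ∀ i, Measurable (ξ i)) (hξ_ident : ∀ i, IdentDistrib (ξ i) (ξ 0) P P)
    (hξ_indep : iIndepFun ξ P)
    (hXξ_indep : IndepFun (fun ω i => X i ω) (fun ω i => ξ i ω) P)
    {g : ℝ → ℝ} (hg : Measurable g) (hg_int : Integrable (fun ω => g (ξ 0 ω)) P)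
    (hg0 : ∀ x, 0 ≤ g x) :
    ∀ᵐ ω ∂P, ∀ ε > 0, ∀ᶠ n : ℕ in atTop, ∀ H, IsClosedHalfspace H →
      |(n : ℝ)⁻¹ * ∑ i ∈ Finset.range n, g (ξ i ω) * H.indicator 1 (X i ω)
        - (∫ ω, g (ξ 0 ω) ∂P) * μ.real H| ≤ ε := by
  set c := ∫ ω, g (ξ 0 ω) ∂P with hc
  have hc0 : 0 ≤ c := integral_nonneg fun ω => hg0 _
  -- Countably many values of `ε` suffice, so the null set can be chosen independently of `ε`.
  suffices h : ∀ ε > 0, ∀ᵐ ω ∂P, ∀ᶠ n : ℕ in atTop, ∀ H, IsClosedHalfspace H →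
      |(n : ℝ)⁻¹ * ∑ i ∈ Finset.range n, g (ξ i ω) * H.indicator 1 (X i ω)
        - c * μ.real H| ≤ ε by
    have h' := ae_all_iff.2 fun k : ℕ => h (1 / ((k : ℝ) + 1)) (by positivity)
    filter_upwards [h'] with ω hω ε hε
    obtain ⟨k, hk⟩ := exists_nat_one_div_lt hε
    filter_upwards [hω k] with n hn H hH
    exact (hn H hH).trans hk.le
  intro ε hε
  -- The bracket width is multiplied by the mean weight `c`, possibly zero; dividing by `c + 1`
  -- keeps the product below `ε / 2`. The other half is for the strong law.
  obtain ⟨S, hSfin, hS, hbr⟩ := exists_finite_brackets hC1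
    (ε := ε / (2 * (c + 1))) (by positivity)
  have hεc : c * (ε / (2 * (c + 1))) ≤ ε / 2 := by
    have : c * (ε / (2 * (c + 1))) = ε / 2 * (c / (c + 1)) := by field_simp
    rw [this]
    exact mul_le_of_le_one_right (by positivity) ((div_le_one (by positivity)).2 (by linarith))
  have hlaw {A : Set (EuclideanSpace ℝ (Fin d))} (hA : MeasurableSet A) :=
    ae_tendsto_weighted_mass hX_meas hX_law hX_indep hξ_meas hξ_ident hξ_indep hXξ_indep
      hg hg_int hA
  have hall : ∀ᵐ ω ∂P, ∀ p ∈ S, ∀ᶠ n : ℕ in atTop,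
      c * μ.real p.1 - ε / 2
        < (n : ℝ)⁻¹ * ∑ i ∈ Finset.range n, g (ξ i ω) * p.1.indicator 1 (X i ω) ∧
      (n : ℝ)⁻¹ * ∑ i ∈ Finset.range n, g (ξ i ω) * p.2.indicator 1 (X i ω)
        < c * μ.real p.2 + ε / 2 := by
    refine (ae_ball_iff hSfin.countable).2 fun p hp => ?_
    filter_upwards [hlaw (hS p hp).1, hlaw (hS p hp).2.1] with ω h1 h2
    exact (h1.eventually_const_lt (by linarith)).and (h2.eventually_lt_const (by linarith))
  filter_upwards [hall] with ω hω
  filter_upwards [(eventually_all_finite hSfin).2 hω] with n hn H hH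
  obtain ⟨p, hp, hp1, hp2⟩ := hbr H hH
  obtain ⟨hn1, hn2⟩ := hn p hp
  -- Nonnegativity of the weights is used here.
  have hmono {A B : Set (EuclideanSpace ℝ (Fin d))} (hAB : A ⊆ B) :
      (n : ℝ)⁻¹ * ∑ i ∈ Finset.range n, g (ξ i ω) * A.indicator 1 (X i ω)
        ≤ (n : ℝ)⁻¹ * ∑ i ∈ Finset.range n, g (ξ i ω) * B.indicator 1 (X i ω) := by
    refine mul_le_mul_of_nonneg_left (Finset.sum_le_sum fun i _ => mul_le_mul_of_nonneg_left
      ?_ (hg0 _)) (by positivity)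
    exact Set.indicator_le_indicator_of_subset hAB (fun _ => zero_le_one' ℝ) _
  have m1 := hmono hp1
  have m2 := hmono hp2
  have q1 : c * μ.real p.1 ≤ c * μ.real H :=
    mul_le_mul_of_nonneg_left (measureReal_mono hp1) hc0
  have q2 : c * μ.real H ≤ c * μ.real p.2 :=
    mul_le_mul_of_nonneg_left (measureReal_mono hp2) hc0
  have q3 : c * μ.real p.2 ≤ c * μ.real p.1 + ε / 2 := by
    have := mul_le_mul_of_nonneg_left (hS p hp).2.2 hc0
    linarith
  exact abs_le.2 ⟨by linarith, by linarith⟩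

theorem weightedEmpirical_apply (X : ℕ → EuclideanSpace ℝ (Fin d)) (ξ : ℕ → ℝ) (n : ℕ)
    {H : Set (EuclideanSpace ℝ (Fin d))} (hH : MeasurableSet H) :
    weightedEmpirical X ξ n H =
      (n : ℝ)⁻¹ * ∑ i ∈ Finset.range n, ξ i * H.indicator 1 (X i) := by
  have hsum (s : Finset ℕ) :
      (∑ i ∈ s, ξ i • (Measure.dirac (X i)).toSignedMeasure) H
        = ∑ i ∈ s, ξ i * H.indicator 1 (X i) := by
    induction s using Finset.cons_induction with
    | empty => simp
    | cons a s ha ih =>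
      rw [Finset.sum_cons, Finset.sum_cons, add_apply, ih, smul_apply,
        Measure.toSignedMeasure_apply_measurable hH, smul_eq_mul]
      congr 2
      by_cases h : X a ∈ H <;> simp [Measure.real, hH, h]
  rw [weightedEmpirical, smul_apply, hsum, smul_eq_mul]

/-- The Glivenko-Cantelli theorem for closed halfspaces and weighted empirical measures. -/
theorem ae_uniform_weightedEmpirical {μ : Measure (EuclideanSpace ℝ (Fin d))}
    [IsProbabilityMeasure μ] (hC1 : NoMassOnHyperplanes μ)
    {Ω : Type*} [MeasurableSpace Ω] {P : Measure Ω} [IsProbabilityMeasure P]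
    {X : ℕ → Ω → EuclideanSpace ℝ (Fin d)} {ξ : ℕ → Ω → ℝ}
    (hX_meas : ∀ i, Measurable (X i)) (hX_law : ∀ i, P.map (X i) = μ)
    (hX_indep : iIndepFun X P)
    (hξ_meas : ∀ i, Measurable (ξ i)) (hξ_ident : ∀ i, IdentDistrib (ξ i) (ξ 0) P P)
    (hξ_indep : iIndepFun ξ P)
    (hξ_int : Integrable (ξ 0) P) (hξ_mean : ∫ ω, ξ 0 ω ∂P = 1)
    (hXξ_indep : IndepFun (fun ω i => X i ω) (fun ω i => ξ i ω) P) :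
    ∀ᵐ ω ∂P, ∀ ε > 0, ∀ᶠ n : ℕ in atTop, ∀ H, IsClosedHalfspace H →
      |weightedEmpirical (fun i => X i ω) (fun i => ξ i ω) n H - μ.real H| ≤ ε := by
  have hp := ae_uniform_weighted_mass_of_nonneg hC1 hX_meas hX_law hX_indep hξ_meas hξ_ident
    hξ_indep hXξ_indep (g := fun x => max x 0) (by fun_prop) hξ_int.pos_part
    (fun x => le_max_right _ _)
  have hm := ae_uniform_weighted_mass_of_nonneg hC1 hX_meas hX_law hX_indep hξ_meas hξ_ident
    hξ_indep hXξ_indep (g := fun x => max (-x) 0) (by fun_prop) hξ_int.neg_part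
    (fun x => le_max_right _ _)
  have hsplit (x : ℝ) : x = max x 0 - max (-x) 0 := by
    rcases le_total x 0 with h | h
    · rw [max_eq_right h, max_eq_left (by linarith)]; ring
    · rw [max_eq_left h, max_eq_right (by linarith)]; ring
  have hmean : (∫ ω, max (ξ 0 ω) 0 ∂P) - ∫ ω, max (-ξ 0 ω) 0 ∂P = 1 := by
    rw [← integral_sub hξ_int.pos_part hξ_int.neg_part, ← hξ_mean]
    exact integral_congr_ae (ae_of_all _ fun ω => (hsplit _).symm)
  filter_upwards [hp, hm] with ω h1 h2 ε hε
  filter_upwards [h1 (ε / 2) (half_pos hε), h2 (ε / 2) (half_pos hε)] with n k1 k2 H hH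
  have k := (abs_sub _ _).trans (add_le_add (k1 H hH) (k2 H hH))
  rw [add_halves] at k
  refine le_of_eq_of_le (congrArg _ ?_) k
  rw [weightedEmpirical_apply _ _ _ hH.measurableSet]
  have : ∑ i ∈ Finset.range n, ξ i ω * H.indicator 1 (X i ω) =
      ∑ i ∈ Finset.range n, max (ξ i ω) 0 * H.indicator 1 (X i ω) -
      ∑ i ∈ Finset.range n, max (-ξ i ω) 0 * H.indicator 1 (X i ω) := by
    rw [← Finset.sum_sub_distrib]
    refine Finset.sum_congr rfl fun i _ => ?_
    rw [← sub_mul, ← hsplit]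
  rw [this]
  linear_combination μ.real H * hmean

/-! ### Depth under uniform perturbation of halfspace masses. -/

theorem depth_le_of_mem {ν : SignedMeasure (EuclideanSpace ℝ (Fin d))} {c : ℝ}
    (hν : ∀ H, IsClosedHalfspace H → c ≤ ν H) {x : EuclideanSpace ℝ (Fin d)}
    {H : Set (EuclideanSpace ℝ (Fin d))} (hH : IsClosedHalfspace H) (hx : x ∈ H) :
    depth ν x ≤ ν H :=
  csInf_le ⟨c, by rintro _ ⟨H', hH', rfl⟩; exact hν H' hH'.1⟩ ⟨H, ⟨hH, hx⟩, rfl⟩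

/-- Nontriviality supplies a unit vector, so that the infimum is not over the empty family. -/
theorem le_depth [Nontrivial (EuclideanSpace ℝ (Fin d))]
    {ν : SignedMeasure (EuclideanSpace ℝ (Fin d))} {c : ℝ} {x : EuclideanSpace ℝ (Fin d)}
    (h : ∀ H, IsClosedHalfspace H → x ∈ H → c ≤ ν H) : c ≤ depth ν x := by
  obtain ⟨u, hu⟩ := exists_norm_eq (EuclideanSpace ℝ (Fin d)) zero_le_one
  refine le_csInf ⟨_, closedHalfspace u (inner ℝ x u), ⟨⟨u, _, hu, rfl⟩, le_rfl (a := inner ℝ x u)⟩,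
    rfl⟩ ?_
  rintro _ ⟨H, hH, rfl⟩
  exact h H hH.1 hH.2

/-- The lower bound `c` passes to `ν'` as `c - ε`; both real infima are then genuine, although
signed masses may be negative. -/
theorem abs_depth_sub_depth_le [Nontrivial (EuclideanSpace ℝ (Fin d))]
    {ν ν' : SignedMeasure (EuclideanSpace ℝ (Fin d))} {c ε : ℝ}
    (hν : ∀ H, IsClosedHalfspace H → c ≤ ν H)
    (h : ∀ H, IsClosedHalfspace H → |ν' H - ν H| ≤ ε) (x : EuclideanSpace ℝ (Fin d)) :
    |depth ν' x - depth ν x| ≤ ε := by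
  have hν' (H) (hH : IsClosedHalfspace H) : c - ε ≤ ν' H := by
    linarith [hν H hH, (abs_le.1 (h H hH)).1]
  have h1 : depth ν' x - ε ≤ depth ν x := le_depth fun H hH hx => by
    linarith [depth_le_of_mem hν' hH hx, (abs_le.1 (h H hH)).2]
  have h2 : depth ν x - ε ≤ depth ν' x := le_depth fun H hH hx => by
    linarith [depth_le_of_mem hν hH hx, (abs_le.1 (h H hH)).1]
  exact abs_le.2 ⟨by linarith, by linarith⟩

theorem trimmedRegion_antitone (ν : SignedMeasure (EuclideanSpace ℝ (Fin d))) :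
    Antitone (trimmedRegion ν) :=
  fun _ _ h _ hx => h.trans hx

/-! ### Compactness of the regions and attainment of the depth. -/

variable {μ : Measure (EuclideanSpace ℝ (Fin d))} [IsProbabilityMeasure μ]

theorem IsClosedHalfspace.toSignedMeasure_apply {H : Set (EuclideanSpace ℝ (Fin d))}
    (hH : IsClosedHalfspace H) : μ.toSignedMeasure H = μ.real H :=
  Measure.toSignedMeasure_apply_measurable hH.measurableSet

theorem IsClosedHalfspace.toSignedMeasure_nonneg {H : Set (EuclideanSpace ℝ (Fin d))}
    (hH : IsClosedHalfspace H) : 0 ≤ μ.toSignedMeasure H := by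
  rw [hH.toSignedMeasure_apply]; exact measureReal_nonneg

theorem depth_le_measureReal {u : EuclideanSpace ℝ (Fin d)} (hu : ‖u‖ = 1) {t : ℝ}
    {x : EuclideanSpace ℝ (Fin d)} (hx : inner ℝ x u ≤ t) :
    depth μ.toSignedMeasure x ≤ μ.real (closedHalfspace u t) := by
  have hH : IsClosedHalfspace (closedHalfspace u t) := ⟨u, t, hu, rfl⟩
  rw [← hH.toSignedMeasure_apply]
  exact depth_le_of_mem (fun _ => IsClosedHalfspace.toSignedMeasure_nonneg) hH hx

/-- A point far out lies in a halfspace that misses a ball carrying almost all the mass. -/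
theorem isBounded_trimmedRegion {α : ℝ} (hα : 0 < α) :
    Bornology.IsBounded (trimmedRegion μ.toSignedMeasure α) := by
  obtain ⟨R, hR0, hR⟩ := exists_measureReal_compl_closedBall_lt μ hα
  refine Metric.isBounded_closedBall.subset (t := Metric.closedBall 0 R) fun x hx => ?_
  by_contra hxR
  have hxR : R < ‖x‖ := by simpa using hxR
  have hx0 : 0 < ‖x‖ := hR0.trans hxR
  have hu : ‖-(‖x‖⁻¹ • x)‖ = 1 := by
    rw [norm_neg, norm_smul, norm_inv, norm_norm, inv_mul_cancel₀ hx0.ne']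
  have hxu : inner ℝ x (-(‖x‖⁻¹ • x)) = -‖x‖ := by
    rw [inner_neg_right, real_inner_smul_right, real_inner_self_eq_norm_sq]; field_simp
  have h1 := depth_le_measureReal (μ := μ) hu hxu.le
  have h2 : closedHalfspace (-(‖x‖⁻¹ • x)) (-‖x‖) ⊆ (Metric.closedBall 0 R)ᶜ := by
    intro z hz hzR
    have hz : inner ℝ z (-(‖x‖⁻¹ • x)) ≤ -‖x‖ := hz
    have h3 := neg_le_of_abs_le (abs_real_inner_le_norm z (-(‖x‖⁻¹ • x)))
    rw [hu, mul_one] at h3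
    have h4 : ‖z‖ ≤ R := by simpa using hzR
    linarith
  have h3 : α ≤ depth μ.toSignedMeasure x := hx
  linarith [measureReal_mono (μ := μ) h2]

/-- A halfspace of mass below `α` can be widened at the cost of a thin strip; it then contains a
neighbourhood of the point and still has mass below `α`. -/
theorem isClosed_trimmedRegion [Nontrivial (EuclideanSpace ℝ (Fin d))]
    (hC1 : NoMassOnHyperplanes μ) (α : ℝ) :
    IsClosed (trimmedRegion μ.toSignedMeasure α) := by
  rw [← isOpen_compl_iff, isOpen_iff_mem_nhds]
  intro x hx
  have hx : ¬ α ≤ depth μ.toSignedMeasure x := hx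
  obtain ⟨H, ⟨u, t, hu, rfl⟩, hxH, hHα⟩ : ∃ H, IsClosedHalfspace H ∧ x ∈ H ∧
      μ.toSignedMeasure H < α := by
    by_contra! h
    exact hx (le_depth h)
  rw [IsClosedHalfspace.toSignedMeasure_apply ⟨u, t, hu, rfl⟩] at hHα
  obtain ⟨δ, hδ0, hδ⟩ := exists_strip_measure_lt hC1 hu t (ENNReal.ofReal_pos.2 (sub_pos.2 hHα))
  have hδ' : μ.real {z | |inner ℝ z u - t| ≤ δ} < α - μ.real (closedHalfspace u t) := by
    rwa [Measure.real, ← ENNReal.lt_ofReal_iff_toReal_lt (by finiteness)]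
  have hsub : closedHalfspace u (t + δ) ⊆
      closedHalfspace u t ∪ {z | |inner ℝ z u - t| ≤ δ} := by
    intro z hz
    by_cases h : inner ℝ z u ≤ t
    · exact Or.inl h
    · have hz : inner ℝ z u ≤ t + δ := hz
      have h' : |inner ℝ z u - t| ≤ δ := abs_le.2 ⟨by linarith, by linarith⟩
      exact Or.inr h'
  have hlt : μ.real (closedHalfspace u (t + δ)) < α := by
    have h1 := measureReal_mono (μ := μ) hsub
    have h2 := measureReal_union_le (μ := μ) (closedHalfspace u t) {z | |inner ℝ z u - t| ≤ δ}
    linarith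
  have hxH : inner ℝ x u ≤ t := hxH
  have hopen : IsOpen {y : EuclideanSpace ℝ (Fin d) | inner ℝ y u < t + δ} :=
    isOpen_lt (by fun_prop) continuous_const
  filter_upwards [hopen.mem_nhds (show inner ℝ x u < t + δ by linarith)] with y hy hyα
  exact absurd ((depth_le_measureReal hu (le_of_lt hy)).trans_lt hlt) (not_lt.2 hyα)

theorem isCompact_trimmedRegion [Nontrivial (EuclideanSpace ℝ (Fin d))]
    (hC1 : NoMassOnHyperplanes μ) {α : ℝ} (hα : 0 < α) :
    IsCompact (trimmedRegion μ.toSignedMeasure α) :=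
  Metric.isCompact_of_isClosed_isBounded (isClosed_trimmedRegion hC1 α) (isBounded_trimmedRegion hα)

/-- The infimum defining the depth is attained at a halfspace with the point on its boundary. -/
theorem exists_depth_eq [Nontrivial (EuclideanSpace ℝ (Fin d))]
    (hC1 : NoMassOnHyperplanes μ) (x : EuclideanSpace ℝ (Fin d)) :
    ∃ u, ‖u‖ = 1 ∧
      depth μ.toSignedMeasure x = μ.real (closedHalfspace u (inner ℝ x u)) := by
  -- The indicators of the halfspaces converge off the boundary hyperplane, which is null by (C1).
  have hcont : ContinuousOn (fun u => μ.real (closedHalfspace u (inner ℝ x u)))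
      (Metric.sphere 0 1) := by
    intro u hu
    have hu : ‖u‖ = 1 := by simpa using hu
    refine ContinuousAt.continuousWithinAt ?_
    refine (ENNReal.tendsto_toReal (by finiteness)).comp
      (tendsto_measure_of_ae_tendsto_indicator_of_isFiniteMeasure _
        (measurableSet_closedHalfspace _ _) (fun v => measurableSet_closedHalfspace _ _) ?_)
    have h0 : ∀ᵐ z ∂μ, z ∉ hyperplane u (inner ℝ x u) :=
      measure_eq_zero_iff_ae_notMem.1 (hC1 _ ⟨u, _, hu, rfl⟩)
    filter_upwards [h0] with z hz
    have hz : inner ℝ z u ≠ inner ℝ x u := hz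
    have c1 : Continuous fun v : EuclideanSpace ℝ (Fin d) => inner ℝ z v := by fun_prop
    have c2 : Continuous fun v : EuclideanSpace ℝ (Fin d) => inner ℝ x v := by fun_prop
    rcases lt_or_gt_of_ne hz with h | h
    · filter_upwards [(isOpen_lt c1 c2).mem_nhds h] with v hv
      exact ⟨fun _ => h.le, fun _ => le_of_lt hv⟩
    · filter_upwards [(isOpen_lt c2 c1).mem_nhds h] with v hv
      exact ⟨fun h' => absurd h' (not_le.2 hv), fun h' => absurd h' (not_le.2 h)⟩
  obtain ⟨u, hu, hmin⟩ := (isCompact_sphere (0 : EuclideanSpace ℝ (Fin d)) 1).exists_isMinOn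
    (NormedSpace.sphere_nonempty.2 zero_le_one) hcont
  have hu1 : ‖u‖ = 1 := by simpa using hu
  refine ⟨u, hu1, (depth_le_measureReal hu1 le_rfl).antisymm (le_depth ?_)⟩
  rintro _ ⟨v, t, hv, rfl⟩ hx
  rw [IsClosedHalfspace.toSignedMeasure_apply ⟨v, t, hv, rfl⟩]
  -- Among parallel halfspaces containing `x`, the one with `x` on its boundary is the smallest.
  exact (hmin (show v ∈ Metric.sphere 0 1 by simpa using hv)).trans
    (measureReal_mono fun z (hz : inner ℝ z v ≤ inner ℝ x v) => hz.trans hx)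

/-! ### Continuity of the regions in the level. -/

/-- Moving towards a point of depth larger than `α` makes the depth larger than `α`. -/
theorem lt_depth_add_smul_sub [Nontrivial (EuclideanSpace ℝ (Fin d))]
    (hC1 : NoMassOnHyperplanes μ) (hC2 : ContiguousSupport μ) {α : ℝ} (hα : 0 < α)
    {x x₀ : EuclideanSpace ℝ (Fin d)} (hx : α ≤ depth μ.toSignedMeasure x)
    (hx₀ : α < depth μ.toSignedMeasure x₀) {s : ℝ} (hs : 0 < s) (hs1 : s ≤ 1) :
    α < depth μ.toSignedMeasure (x + s • (x₀ - x)) := by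
  by_contra! hy
  obtain ⟨u, hu, hD⟩ := exists_depth_eq hC1 (x + s • (x₀ - x))
  rw [hD] at hy
  set b := inner ℝ (x + s • (x₀ - x)) u with hb
  have hb' : b = inner ℝ x u + s * (inner ℝ x₀ u - inner ℝ x u) := by
    rw [hb, inner_add_left, real_inner_smul_left, inner_sub_left]
  -- The minimal halfspace at the intermediate point has mass at most `α`, so it cannot contain
  -- `x₀`. Hence `x` lies strictly inside it.
  have h0 : b < inner ℝ x₀ u := by
    by_contra! h
    linarith [depth_le_measureReal (μ := μ) hu h]
  have hxb : inner ℝ x u < b := by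
    have h1 : inner ℝ x u < inner ℝ x₀ u := by
      by_contra! h
      nlinarith [mul_nonneg (sub_nonneg.2 hs1) (sub_nonneg.2 h)]
    rw [hb']
    linarith [mul_pos hs (sub_pos.2 h1)]
  have hHx : α ≤ μ.real (closedHalfspace u (inner ℝ x u)) :=
    hx.trans (depth_le_measureReal hu le_rfl)
  have hcover : 1 ≤ μ.real (closedHalfspace u b) + μ.real (closedHalfspace (-u) (-b)) := by
    have hU : Set.univ ⊆ closedHalfspace u b ∪ closedHalfspace (-u) (-b) := by
      intro z _
      rcases le_total (inner ℝ z u) b with h | h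
      · exact Or.inl h
      · have h' : inner ℝ z (-u) ≤ -b := by rw [inner_neg_right]; linarith
        exact Or.inr h'
    have h1 := measureReal_mono (μ := μ) hU
    rw [probReal_univ] at h1
    exact h1.trans (measureReal_union_le _ _)
  have hα1 : α < 1 :=
    hx₀.trans_le ((depth_le_measureReal hu le_rfl).trans measureReal_le_one)
  have hdisj : Disjoint (closedHalfspace u (inner ℝ x u)) (closedHalfspace (-u) (-b)) := by
    refine Set.disjoint_left.2 fun z hz hz' => ?_
    have hz : inner ℝ z u ≤ inner ℝ x u := hz
    have hz' : inner ℝ z (-u) ≤ -b := hz'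
    rw [inner_neg_right] at hz'
    linarith
  -- The halfspace through `x` has mass at least `α`, the opposite one at `b` at least `1 - α`, and
  -- an open slab separates them: (C2) is violated.
  have hlt := hC2 _ _ ⟨u, _, hu, rfl⟩ ⟨-u, _, by rwa [norm_neg], rfl⟩ hdisj
    (ENNReal.toReal_pos_iff.1 (hα.trans_le hHx)).1
    (ENNReal.toReal_pos_iff.1
      (show 0 < μ.real (closedHalfspace (-u) (-b)) by linarith)).1
  have hlt' := (ENNReal.toReal_lt_toReal (by finiteness) ENNReal.one_ne_top).2 hlt
  rw [ENNReal.toReal_add (by finiteness) (by finiteness), ENNReal.toReal_one] at hlt'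
  change μ.real _ + μ.real _ < 1 at hlt'
  linarith

/-- Each point of the region has points of depth strictly above `α` arbitrarily near; compactness
makes the gain in level uniform. -/
theorem exists_trimmedRegion_subset_thickening_of_lt [Nontrivial (EuclideanSpace ℝ (Fin d))]
    (hC1 : NoMassOnHyperplanes μ) (hC2 : ContiguousSupport μ) {α : ℝ} (hα : 0 < α)
    {x₀ : EuclideanSpace ℝ (Fin d)} (hx₀ : α < depth μ.toSignedMeasure x₀) {δ : ℝ} (hδ : 0 < δ) :
    ∃ η > 0, trimmedRegion μ.toSignedMeasure α ⊆
      Metric.thickening δ (trimmedRegion μ.toSignedMeasure (α + η)) := by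
  let U : ℕ → Set (EuclideanSpace ℝ (Fin d)) := fun k =>
    Metric.thickening δ (trimmedRegion μ.toSignedMeasure (α + 1 / ((k : ℝ) + 1)))
  have hU : Monotone U := fun i j hij => Metric.thickening_subset_of_subset δ
    (trimmedRegion_antitone _ (by gcongr))
  have hcover : trimmedRegion μ.toSignedMeasure α ⊆ ⋃ k, U k := by
    intro x hx
    have hc : Tendsto (fun s : ℝ => dist x (x + s • (x₀ - x))) (𝓝[>] 0) (𝓝 0) := by
      have : Continuous fun s : ℝ => dist x (x + s • (x₀ - x)) := by fun_prop
      simpa using (this.tendsto 0).mono_left nhdsWithin_le_nhds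
    obtain ⟨s, hs, hs0, hs1⟩ := ((hc.eventually_lt_const hδ).and
      (Ioc_mem_nhdsGT (zero_lt_one' ℝ))).exists
    have hlt := lt_depth_add_smul_sub hC1 hC2 hα hx hx₀ hs0 hs1
    obtain ⟨k, hk⟩ := exists_nat_one_div_lt (sub_pos.2 hlt)
    refine Set.mem_iUnion.2 ⟨k, Metric.mem_thickening_iff.2 ⟨_, ?_, hs⟩⟩
    change α + 1 / ((k : ℝ) + 1) ≤ depth μ.toSignedMeasure _
    linarith
  obtain ⟨k, hk⟩ := (isCompact_trimmedRegion hC1 hα).elim_directed_cover U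
    (fun _ => Metric.isOpen_thickening) hcover hU.directed_le
  exact ⟨_, by positivity, hk⟩

/-- The regions at levels increasing to `α` are compact and intersect in the region at `α`, so one
of them already lies in the given neighbourhood. -/
theorem exists_trimmedRegion_sub_subset_thickening [Nontrivial (EuclideanSpace ℝ (Fin d))]
    (hC1 : NoMassOnHyperplanes μ) {α : ℝ} (hα : 0 < α) {δ : ℝ} (hδ : 0 < δ) :
    ∃ η > 0, trimmedRegion μ.toSignedMeasure (α - η) ⊆
      Metric.thickening δ (trimmedRegion μ.toSignedMeasure α) := by
  let V : ℕ → Set (EuclideanSpace ℝ (Fin d)) := fun k =>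
    -- The denominator exceeds 1, which keeps the level positive and the region compact.
    trimmedRegion μ.toSignedMeasure (α - α / ((k : ℝ) + 2))
  have hV : Antitone V := fun i j hij => trimmedRegion_antitone _ (by gcongr)
  have hVc (k : ℕ) : IsCompact (V k) := by
    refine isCompact_trimmedRegion hC1 (sub_pos.2 ((div_lt_self hα ?_)))
    have : (0 : ℝ) ≤ k := k.cast_nonneg
    linarith
  obtain ⟨k, hk⟩ := exists_subset_nhds_of_isCompact' hV.directed_ge hVc (fun k => (hVc k).isClosed)
    (U := Metric.thickening δ (trimmedRegion μ.toSignedMeasure α)) (fun x hx => by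
      refine Metric.isOpen_thickening.mem_nhds (Metric.self_subset_thickening hδ _ ?_)
      have hlim : Tendsto (fun k : ℕ => α - α / ((k : ℝ) + 2)) atTop (𝓝 (α - 0)) :=
        tendsto_const_nhds.sub (tendsto_const_nhds.div_atTop
          (tendsto_atTop_add_const_right _ _ tendsto_natCast_atTop_atTop))
      rw [sub_zero] at hlim
      exact le_of_tendsto' hlim fun k => Set.mem_iInter.1 hx k)
  exact ⟨_, by positivity, hk⟩

/-! ### Convergence of the trimmed regions. -/

/-- Uniform convergence on closed halfspaces implies convergence of depth trimmed regions. -/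
theorem tendsto_hausdorffEDist_trimmedRegion
    (hC1 : NoMassOnHyperplanes μ) (hC2 : ContiguousSupport μ) {α : ℝ} (hα : 0 < α)
    (hα_lt : α < maxDepth μ.toSignedMeasure)
    {ν : ℕ → SignedMeasure (EuclideanSpace ℝ (Fin d))}
    (hν : ∀ ε > 0, ∀ᶠ n in atTop, ∀ H, IsClosedHalfspace H → |ν n H - μ.real H| ≤ ε) :
    Tendsto (fun n => Metric.hausdorffEDist (trimmedRegion μ.toSignedMeasure α)
      (trimmedRegion (ν n) α)) atTop (𝓝 0) := by
  obtain ⟨_, ⟨x₀, rfl⟩, hx₀⟩ := exists_lt_of_lt_csSup (Set.range_nonempty _) hα_lt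
  -- In dimension zero there are no unit vectors, hence no halfspaces, and the depth is `sInf ∅ =
  -- 0`, not above `α`.
  have : Nontrivial (EuclideanSpace ℝ (Fin d)) := by
    by_contra h
    rw [not_nontrivial_iff_subsingleton] at h
    have he : {H : Set (EuclideanSpace ℝ (Fin d)) | IsClosedHalfspace H ∧ x₀ ∈ H} = ∅ := by
      refine Set.eq_empty_of_forall_notMem ?_
      rintro _ ⟨⟨u, t, hu, rfl⟩, -⟩
      rw [Subsingleton.elim u 0, norm_zero] at hu
      exact zero_ne_one hu
    rw [depth, he, Set.image_empty, Real.sInf_empty] at hx₀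
    exact hα.not_gt hx₀
  rw [ENNReal.tendsto_nhds_zero]
  intro ε hε
  obtain ⟨δ, hδ0, hδ⟩ := ENNReal.lt_iff_exists_nnreal_btwn.1 hε
  have hδ0 : 0 < (δ : ℝ) := by exact_mod_cast hδ0
  obtain ⟨η₁, hη₁, h1⟩ := exists_trimmedRegion_subset_thickening_of_lt hC1 hC2 hα hx₀ hδ0
  obtain ⟨η₂, hη₂, h2⟩ := exists_trimmedRegion_sub_subset_thickening hC1 hα hδ0
  have hedist {x y : EuclideanSpace ℝ (Fin d)} (h : dist x y < δ) : edist x y ≤ ε := by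
    refine le_trans ?_ hδ.le
    rw [edist_le_coe]
    exact_mod_cast h.le
  filter_upwards [hν (min η₁ η₂) (lt_min hη₁ hη₂)] with n hn
  have hdepth := abs_depth_sub_depth_le (ν := μ.toSignedMeasure) (ν' := ν n)
    (fun _ => IsClosedHalfspace.toSignedMeasure_nonneg)
    (fun H hH => by rw [hH.toSignedMeasure_apply]; exact hn H hH)
  refine Metric.hausdorffEDist_le_of_mem_edist (fun x hx => ?_) (fun x hx => ?_)
  · obtain ⟨y, hy, hxy⟩ := Metric.mem_thickening_iff.1 (h1 hx)
    refine ⟨y, ?_, hedist hxy⟩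
    have hy : α + η₁ ≤ depth μ.toSignedMeasure y := hy
    change α ≤ depth (ν n) y
    linarith [(abs_le.1 (hdepth y)).1, min_le_left η₁ η₂]
  · have hx : α ≤ depth (ν n) x := hx
    have hx' : α - η₂ ≤ depth μ.toSignedMeasure x := by
      linarith [(abs_le.1 (hdepth x)).2, min_le_right η₁ η₂]
    obtain ⟨y, hy, hxy⟩ := Metric.mem_thickening_iff.1 (h2 hx')
    exact ⟨y, hy, hedist hxy⟩

end HalfspaceDepth

theorem mainTheorem7 {d : ℕ}
    (μ : Measure (EuclideanSpace ℝ (Fin d))) [IsProbabilityMeasure μ]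
    (hC1 : HalfspaceDepth.NoMassOnHyperplanes μ)
    (hC2 : HalfspaceDepth.ContiguousSupport μ)
    {Ω : Type*} [MeasurableSpace Ω] (P : Measure Ω) [IsProbabilityMeasure P]
    (X : ℕ → Ω → EuclideanSpace ℝ (Fin d)) (ξ : ℕ → Ω → ℝ)
    (hX_meas : ∀ i, Measurable (X i)) (hX_law : ∀ i, P.map (X i) = μ)
    (hX_indep : iIndepFun X P)
    (hξ_meas : ∀ i, Measurable (ξ i)) (hξ_ident : ∀ i, IdentDistrib (ξ i) (ξ 0) P P)
    (hξ_indep : iIndepFun ξ P)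
    (hξ_int : Integrable (ξ 0) P) (hξ_mean : ∫ ω, ξ 0 ω ∂P = 1)
    (hXξ_indep : IndepFun (fun ω i => X i ω) (fun ω i => ξ i ω) P)
    (α : ℝ) (hα_pos : 0 < α) (hα_lt : α < HalfspaceDepth.maxDepth μ.toSignedMeasure) :
    ∀ᵐ ω ∂P, Tendsto
      (fun n : ℕ => Metric.hausdorffEDist
        (HalfspaceDepth.trimmedRegion μ.toSignedMeasure α)
        (HalfspaceDepth.trimmedRegion
          (HalfspaceDepth.weightedEmpirical (fun i => X i ω) (fun i => ξ i ω) n) α))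
      atTop (𝓝 0) := by
  filter_upwards [HalfspaceDepth.ae_uniform_weightedEmpirical hC1 hX_meas hX_law hX_indep hξ_meas
    hξ_ident hξ_indep hξ_int hξ_mean hXξ_indep] with ω hω
  exact HalfspaceDepth.tendsto_hausdorffEDist_trimmedRegion hC1 hC2 hα_pos hα_lt hω
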